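/- Let $n\ge 1$ and let $\Gamma_1,\dots,\Gamma_n$ be real vortex strengths. Pairwise distinct points $x_1,\dots,x_n\in\mathbb{R}^2$ form a \emph{relative equilibrium} of the $n$-vortex problem if there are $\lambda\in\mathbb{R}\setminus\{0\}$ and $c\in\mathbb{R}^2$ with $$-\lambda(x_i-c)=\sum_{j\neq i}\frac{\Gamma_j}{\|x_i-x_j\|^2}(x_j-x_i)\qquad (1\le i\le n).$$ It is \emph{strictly planar} if the points do not all lie on one line. A four-vortex configuration is \emph{concave} if one vortex lies strictly inside (in the interior of) the convex hull of the other three, which then form the \emph{exterior triangle}; it is \emph{convex} if no vortex lies in the convex hull of the other three. In a convex configuration two vortices are \emph{adjacent} if the segment joining them is a side of the convex quadrilateral. A configuration has a \emph{line of symmetry} if the reflection in some line permutes the vortices and preserves their strengths; otherwise it is \emph{asymmetric}. \textbf{Theorem.} Let $m\in\mathbb{R}$ and let $x=(x_1,x_2,x_3,x_4)$ be a strictly planar relative equilibrium of the four-vortex problem with $\Gamma_1=\Gamma_2=1$ and $\Gamma_3=\Gamma_4=m$. 1. Suppose $m>0$. If $x$ is convex, then it has a line of symmetry. If $x$ is asymmetric,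 then it is concave, and the two vortices of smaller strength (vortices 3 and 4 if $m<1$, vortices 1 and 2 if $m>1$) are vertices of the exterior triangle. If $m=1$, then $x$ has a line of symmetry. 2. Suppose $m<0$. If $x$ is concave, then it has a line of symmetry. If $x$ is asymmetric, then it is convex and the equal-strength vortices are adjacent: vortices 1 and 2 are adjacent, and vortices 3 and 4 are adjacent. -/

import Mathlib

open scoped EuclideanGeometry

/-- Positions `x i` in the Euclidean plane of `n` point vortices of strengths `Γ i` that form a
relative equilibrium: the vortices are pairwise distinct, and for some angular velocity `ω ≠ 0` and
some centre of rotation `c`,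
`-ω (x i - c) = ∑_{j ≠ i} (Γ j / ‖x i - x j‖ ^ 2) (x j - x i)` for every `i`. -/
def IsRelativeEquilibrium {n : ℕ} (Γ : Fin n → ℝ) (x : Fin n → EuclideanSpace ℝ (Fin 2)) : Prop :=
  Function.Injective x ∧
    ∃ ω : ℝ, ω ≠ 0 ∧ ∃ c : EuclideanSpace ℝ (Fin 2), ∀ i,
      -ω • (x i - c) =
        ∑ j ∈ Finset.univ.erase i, (Γ j / ‖x i - x j‖ ^ 2) • (x j - x i)

/-- The configuration does not lie on a line. -/
def IsStrictlyPlanar {n : ℕ} (x : Fin n → EuclideanSpace ℝ (Fin 2)) : Prop :=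
  ¬ Collinear ℝ (Set.range x)

/-- The strengths of the four vortices: `1, 1, m, m`. -/
def pairStrengths (m : ℝ) : Fin 4 → ℝ := ![1, 1, m, m]

/-- The configuration of vortices of strengths `Γ` has a line of symmetry: the reflection in some
line permutes the vortices and preserves their strengths. -/
def HasLineOfSymmetry {n : ℕ} (Γ : Fin n → ℝ) (x : Fin n → EuclideanSpace ℝ (Fin 2)) : Prop :=
  ∃ p q : EuclideanSpace ℝ (Fin 2), p ≠ q ∧
    ∃ π : Equiv.Perm (Fin n), ∀ i,
      EuclideanGeometry.reflection line[ℝ, p, q] (x i) = x (π i) ∧ Γ (π i) = Γ i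

/-- Vortex `k` lies strictly inside the convex hull of the other vortices. -/
def IsInteriorVortex {n : ℕ} (x : Fin n → EuclideanSpace ℝ (Fin 2)) (k : Fin n) : Prop :=
  x k ∈ interior (convexHull ℝ (x '' {k}ᶜ))

/-- A concave configuration: one vortex lies strictly inside the convex hull of the others. -/
def IsConcaveConfiguration (x : Fin 4 → EuclideanSpace ℝ (Fin 2)) : Prop :=
  ∃ k, IsInteriorVortex x k

/-- A convex configuration: no vortex lies in the convex hull of the others. -/
def IsConvexConfiguration (x : Fin 4 → EuclideanSpace ℝ (Fin 2)) : Prop :=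
  ∀ k, x k ∉ convexHull ℝ (x '' {k}ᶜ)

/-- Vortex `j` is a vertex of the exterior triangle of a concave configuration. -/
def IsOnExteriorTriangle (x : Fin 4 → EuclideanSpace ℝ (Fin 2)) (j : Fin 4) : Prop :=
  ∃ k, IsInteriorVortex x k ∧ j ≠ k

/-- The vortices `i` and `j` of a convex configuration are adjacent: the segment joining them is a
side of the quadrilateral, i.e. the other vortices lie strictly on one side of the line through
`x i` and `x j`. -/
def AreAdjacent (x : Fin 4 → EuclideanSpace ℝ (Fin 2)) (i j : Fin 4) : Prop :=
  ∀ k l, k ≠ i → k ≠ j → l ≠ i → l ≠ j → line[ℝ, x i, x j].SSameSide (x k) (x l)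

/-! Four points that span the plane have one affine dependency up to scale. The signs of its
coefficients β_i (`bary`) decide whether the configuration is concave or convex, which vortex is
interior and which are adjacent, so it suffices to find these signs for asymmetric configurations.
Put β_i = Γ_i D_i. If the total strength is nonzero, the equations of motion force r_ij⁻² = λ(1 + κ
D_i D_j) (`exists_dziobek`). Since ∑_j β_j r_ij² does not depend on i, everything becomes algebra in
D = (a, b, f, g), with a + b + m(f + g) = 0. If a = b or f = g the configuration is a kite, if f + g
= 0 an isosceles trapezoid, and if m = -1 (total strength zero) a rhombus; all are symmetric.
Otherwise two differences of moment equations can be divided by a - b and f - g, and with them the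
remaining one factors: κab = m or mκfg = 1 (`cross_equation`). Exchanging the pairs and replacing m
by 1/m swaps these alternatives. In the first, κfg and κ(f + g)² are explicit rational functions of
m, and (f + g)², (f - g)² > 0 gives the sign of κ, hence those of ab and fg (`signs_of_mul_eq`). -/

/-! ### Algebra of the moment equations -/

/-- The difference of two moment equations, divided by the difference of the two unknowns. -/
lemma pair_equation {m κ a b f g e01 e02 e03 e12 e13 : ℝ} (hab : a ≠ b)
    (h01 : e01 ≠ 0) (h02 : e02 ≠ 0) (h03 : e03 ≠ 0) (h12 : e12 ≠ 0) (h13 : e13 ≠ 0)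
    (he02 : e02 = 1 + κ * (a * f)) (he03 : e03 = 1 + κ * (a * g))
    (he12 : e12 = 1 + κ * (b * f)) (he13 : e13 = 1 + κ * (b * g))
    (ht : b / e01 + m * f / e02 + m * g / e03 = a / e01 + m * f / e12 + m * g / e13) :
    e02 * e12 * (e03 * e13) + m * κ * e01 * (f ^ 2 * (e03 * e13) + g ^ 2 * (e02 * e12)) = 0 := by
  have hba : b - a ≠ 0 := sub_ne_zero.2 hab.symm
  -- Since e12 - e02 = κ f (b - a), the factor b - a splits off; likewise for g.
  have hf : m * f / e02 - m * f / e12 = m * κ * (b - a) * (f ^ 2 / (e02 * e12)) := by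
    rw [div_sub_div _ _ h02 h12, mul_div_assoc']
    congr 1
    rw [he02, he12]; ring
  have hg : m * g / e03 - m * g / e13 = m * κ * (b - a) * (g ^ 2 / (e03 * e13)) := by
    rw [div_sub_div _ _ h03 h13, mul_div_assoc']
    congr 1
    rw [he03, he13]; ring
  have key : (b - a) * (1 / e01 + m * κ * (f ^ 2 / (e02 * e12) + g ^ 2 / (e03 * e13))) = 0 := by
    linear_combination ht - hf - hg
  have key := (mul_eq_zero.1 key).resolve_left hba
  field_simp at key
  linear_combination key

/-- The equation relating the two pairs factors. -/
lemma cross_equation {m κ a b f g e01 e02 e03 e12 e13 e23 : ℝ} (hu : f + g ≠ 0)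
    (hsum : a + b + m * (f + g) = 0)
    (h01 : e01 ≠ 0) (h02 : e02 ≠ 0) (h03 : e03 ≠ 0) (h12 : e12 ≠ 0) (h13 : e13 ≠ 0)
    (h23 : e23 ≠ 0) (he02 : e02 = 1 + κ * (a * f)) (he03 : e03 = 1 + κ * (a * g))
    (he12 : e12 = 1 + κ * (b * f)) (he13 : e13 = 1 + κ * (b * g))
    (hA : e02 * e12 * (e03 * e13) +
      m * κ * e01 * (f ^ 2 * (e03 * e13) + g ^ 2 * (e02 * e12)) = 0)
    (hB : m * (e02 * e12 * (e03 * e13)) +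
      κ * e23 * (a ^ 2 * (e12 * e13) + b ^ 2 * (e02 * e03)) = 0)
    (ht : b / e01 + m * f / e02 + m * g / e03 + (a / e01 + m * f / e12 + m * g / e13) =
      (a / e02 + b / e12 + m * g / e23) + (a / e03 + b / e13 + m * f / e23)) :
    κ * (a * b) = m ∨ m * (κ * (f * g)) = 1 := by
  have hA' : 1 / e01 = -(m * κ * (f ^ 2 / (e02 * e12) + g ^ 2 / (e03 * e13))) := by
    field_simp
    linear_combination hA
  have hB' : m / e23 = -(κ * (a ^ 2 / (e02 * e03) + b ^ 2 / (e12 * e13))) := by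
    field_simp
    linear_combination hB
  -- After substituting for 1 / e01 and m / e23, identities such as e02 + e12 = 2 + κ(a + b)f
  -- collapse the two sides to 2m(f/(e02 e12) + g/(e03 e13)) and 2(a/(e02 e03) + b/(e12 e13)).
  have hC : m * (f * (e03 * e13) + g * (e02 * e12)) = a * (e12 * e13) + b * (e02 * e03) := by
    have e : (a + b) * (1 / e01) + m * f / e02 + m * g / e03 + m * f / e12 + m * g / e13 =
        a / e02 + b / e12 + a / e03 + b / e13 + (f + g) * (m / e23) := by
      linear_combination ht
    rw [hA', hB'] at e
    field_simp at e
    rw [he02, he03, he12, he13] at e ⊢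
    linear_combination e / 2
  obtain rfl : a = -b - m * (f + g) := by linear_combination hsum
  rw [he02, he03, he12, he13] at hC
  have : (f + g) * ((κ * ((-b - m * (f + g)) * b) - m) * (m * (κ * (f * g)) - 1)) = 0 := by
    linear_combination hC / 2
  rcases mul_eq_zero.1 ((mul_eq_zero.1 this).resolve_left hu) with h | h
  · exact .inl (by linarith)
  · exact .inr (by linarith)

/-- Solution of the equations in the case `κ a b = m`. -/
lemma signs_of_mul_eq {m κ a b f g e02 e03 e12 e13 : ℝ} (hm : m ≠ 0) (hm1 : m ≠ -1)
    (hfg : f ≠ g) (hu : f + g ≠ 0) (hsum : a + b + m * (f + g) = 0)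
    (h02 : e02 ≠ 0) (h03 : e03 ≠ 0) (h12 : e12 ≠ 0) (h13 : e13 ≠ 0)
    (he02 : e02 = 1 + κ * (a * f)) (he03 : e03 = 1 + κ * (a * g))
    (he12 : e12 = 1 + κ * (b * f)) (he13 : e13 = 1 + κ * (b * g))
    (hA : e02 * e12 * (e03 * e13) +
      m * κ * (1 + κ * (a * b)) * (f ^ 2 * (e03 * e13) + g ^ 2 * (e02 * e12)) = 0)
    (hB : m * (e02 * e12 * (e03 * e13)) +
      κ * (1 + κ * (f * g)) * (a ^ 2 * (e12 * e13) + b ^ 2 * (e02 * e03)) = 0)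
    (hq : κ * (a * b) = m) :
    (0 < m → m < 1 ∧ a * b < 0 ∧ 0 < f * g) ∧ (m < 0 → a * b < 0 ∧ f * g < 0) := by
  have hP : e02 * e12 * (e03 * e13) ≠ 0 := by positivity
  obtain ⟨w, hw⟩ : ∃ w, w = κ * (f + g) ^ 2 := ⟨_, rfl⟩
  obtain ⟨v, hv⟩ : ∃ v, v = κ * (f * g) := ⟨_, rfl⟩
  -- As κab = m and a + b = -m(f + g), the terms in f² and g² cancel, so both products equal 1 - mv.
  -- Cancelling this factor leaves equations linear in v and w.
  have h2 : e02 * e12 = 1 - m * v := by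
    rw [he02, he12, hv]; linear_combination κ * f * hsum + κ * f ^ 2 * hq
  have h3 : e03 * e13 = 1 - m * v := by
    rw [he03, he13, hv]; linear_combination κ * g * hsum + κ * g ^ 2 * hq
  have hPe : e02 * e12 * (e03 * e13) = (1 - m * v) ^ 2 := by rw [h2, h3]; ring
  have hA1 : (1 - m * v) * (1 - m * v + m * (1 + m) * (w - 2 * v)) = 0 := by
    rw [h2, h3, hq] at hA
    linear_combination hA + m * (1 + m) * (1 - m * v) * (hw - 2 * hv)
  have hB1 : m * (1 - m * v) * (-1 - (m + 2) * v) = 0 := by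
    have h4 : κ * (a ^ 2 * (e12 * e13) + b ^ 2 * (e02 * e03)) = 2 * v * m ^ 2 - 2 * m := by
      rw [he02, he03, he12, he13, hv, ← hq]
      linear_combination (κ * (a + b)) * hsum - κ * (a + b) * (f + g) * (-hq)
    rw [hPe, ← hv] at hB
    linear_combination hB - (1 + v) * h4
  have h1 : 1 - m * v ≠ 0 := by
    intro h; apply hP; rw [hPe, h]; ring
  have hA2 := (mul_eq_zero.1 hA1).resolve_left h1
  have hB2 : (m + 2) * v = -1 := by
    linear_combination -(mul_eq_zero.1 hB1).resolve_left (mul_ne_zero hm h1)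
  have hm1' : m + 1 ≠ 0 := fun h => hm1 (by linarith)
  -- Eliminating v leaves a common factor m + 1; this is where m ≠ -1 enters.
  have hw2 : m * ((m + 2) * w) = -2 * (m + 1) := by
    apply mul_left_cancel₀ hm1'
    linear_combination (m + 2) * hA2 + (m + 2 * m * (1 + m)) * hB2
  have hκ : κ ≠ 0 := by rintro rfl; apply hm; rw [← hq]; ring
  have hm2 : m + 2 ≠ 0 := by intro h; rw [h] at hB2; norm_num at hB2
  have d1 : (f - g) ^ 2 * κ = w - 4 * v := by rw [hw, hv]; ring
  have d0 : (f + g) ^ 2 * κ = w := by rw [hw]; ring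
  have p1 : 0 < (f - g) ^ 2 := by have := sub_ne_zero.2 hfg; positivity
  have p0 : 0 < (f + g) ^ 2 := by positivity
  have hq' : a * b * κ = m := by linarith
  have hv' : f * g * κ = v := by linarith
  have hd : m * ((m + 2) * (w - 4 * v)) = 2 * (m - 1) := by linear_combination hw2 - 4 * m * hB2
  constructor
  · intro hpos
    have hw0 : w < 0 := by
      by_contra! h
      have : 0 ≤ m * ((m + 2) * w) := by positivity
      linarith
    have hv0 : v < 0 := by
      by_contra! h
      have : 0 ≤ (m + 2) * v := by positivity
      linarith
    have hκ0 : κ < 0 := by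
      by_contra! h
      have : 0 ≤ (f + g) ^ 2 * κ := by positivity
      linarith
    refine ⟨?_, ?_, ?_⟩
    · have : m * ((m + 2) * ((f - g) ^ 2 * κ)) < 0 :=
        mul_neg_of_pos_of_neg hpos (mul_neg_of_pos_of_neg (by linarith)
          (mul_neg_of_pos_of_neg p1 hκ0))
      rw [d1] at this
      linarith
    · exact neg_of_mul_pos_left (by rw [hq']; exact hpos) hκ0.le
    · exact pos_of_mul_neg_left (by rw [hv']; exact hv0) hκ0.le
  · intro hneg
    have hs : 0 < (m + 2) * ((f - g) ^ 2 * κ) := by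
      rw [d1]; nlinarith
    have hs' : 0 < (m + 2) * κ := by
      have : 0 < (f - g) ^ 2 * ((m + 2) * κ) := by linarith
      exact pos_of_mul_pos_right this p1.le
    -- κ(f + g)² has the sign of κ, so `hw2` confines this alternative to -1 < m < 0, where m + 2 >
    -- 0 and therefore κ > 0.
    have hm1'' : 0 < m + 1 := by
      have : m * ((f + g) ^ 2 * ((m + 2) * κ)) < 0 :=
        mul_neg_of_neg_of_pos hneg (mul_pos p0 hs')
      have e : m * ((f + g) ^ 2 * ((m + 2) * κ)) = m * ((m + 2) * w) := by rw [← d0]; ring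
      linarith
    have hκ0 : 0 < κ := by
      exact pos_of_mul_pos_right hs' (by linarith)
    constructor
    · exact neg_of_mul_neg_left (by rw [hq']; exact hneg) hκ0.le
    · refine neg_of_mul_neg_left (b := κ) ?_ hκ0.le
      rw [hv']
      by_contra! h
      have : 0 ≤ (m + 2) * v := mul_nonneg (by linarith) h
      linarith

/-- Signs of the weights `a, b, f, g` of an asymmetric configuration. -/
lemma asymmetric_signs {m κ a b f g e01 e02 e03 e12 e13 e23 : ℝ} (hm : m ≠ 0) (hm1 : m ≠ -1)
    (hab : a ≠ b) (hfg : f ≠ g) (hu : f + g ≠ 0) (hsum : a + b + m * (f + g) = 0)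
    (h01 : e01 ≠ 0) (h02 : e02 ≠ 0) (h03 : e03 ≠ 0) (h12 : e12 ≠ 0) (h13 : e13 ≠ 0)
    (h23 : e23 ≠ 0) (he01 : e01 = 1 + κ * (a * b)) (he02 : e02 = 1 + κ * (a * f))
    (he03 : e03 = 1 + κ * (a * g)) (he12 : e12 = 1 + κ * (b * f))
    (he13 : e13 = 1 + κ * (b * g)) (he23 : e23 = 1 + κ * (f * g)) {t : ℝ}
    (t0 : b / e01 + m * f / e02 + m * g / e03 = t) (t1 : a / e01 + m * f / e12 + m * g / e13 = t)
    (t2 : a / e02 + b / e12 + m * g / e23 = t) (t3 : a / e03 + b / e13 + m * f / e23 = t) :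
    (0 < m → m < 1 ∧ a * b < 0 ∧ 0 < f * g ∨ 1 < m ∧ 0 < a * b ∧ f * g < 0) ∧
      (m < 0 → a * b < 0 ∧ f * g < 0) := by
  have hA := pair_equation (m := m) hab h01 h02 h03 h12 h13 he02 he03 he12 he13 (t0.trans t1.symm)
  -- Dividing the strengths by m and exchanging the pairs gives the same problem with m⁻¹.
  have hB' := pair_equation (m := m⁻¹) (κ := κ) (a := f) (b := g) (f := a) (g := b) hfg
    h23 h02 h12 h03 h13 (by rw [he02, mul_comm a]) (by rw [he12, mul_comm b])
    (by rw [he03, mul_comm a]) (by rw [he13, mul_comm b]) (by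
      apply mul_left_cancel₀ hm
      rw [mul_add, mul_add, mul_add, mul_add]
      simp only [← mul_div_assoc, mul_inv_cancel_left₀ hm]
      linear_combination t2 - t3)
  have hB : m * (e02 * e12 * (e03 * e13)) +
      κ * e23 * (a ^ 2 * (e12 * e13) + b ^ 2 * (e02 * e03)) = 0 := by
    field_simp at hB'
    linear_combination hB'
  rcases cross_equation hu hsum h01 h02 h03 h12 h13 h23 he02 he03 he12 he13 hA hB
    (by linear_combination t0 + t1 - t2 - t3) with hq | hv
  · obtain ⟨h1, h2⟩ := signs_of_mul_eq hm hm1 hfg hu hsum h02 h03 h12 h13 he02 he03 he12 he13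
      (he01 ▸ hA) (he23 ▸ hB) hq
    exact ⟨fun h => .inl (h1 h), h2⟩
  · have hp : a + b ≠ 0 := fun h => mul_ne_zero hm hu (by linear_combination hsum - h)
    obtain ⟨h1, h2⟩ := signs_of_mul_eq (m := m⁻¹) (κ := κ) (a := f) (b := g) (f := a) (g := b)
      (inv_ne_zero hm) (fun h => hm1 (by rw [← inv_inv m, h]; norm_num)) hab hp
      (by field_simp; linear_combination hsum) h02 h12 h03 h13 (by rw [he02, mul_comm a])
      (by rw [he12, mul_comm b]) (by rw [he03, mul_comm a]) (by rw [he13, mul_comm b])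
      (he23 ▸ hB')
      (by rw [← he01]; field_simp; linear_combination hA) (by field_simp; linear_combination hv)
    refine ⟨fun h => .inr ?_, fun h => (h2 (inv_lt_zero.2 h)).symm⟩
    obtain ⟨h3, h4, h5⟩ := h1 (inv_pos.2 h)
    exact ⟨(inv_lt_one₀ h).1 h3, h5, h4⟩

/-! ### Affine dependency of four points -/

/-- Twice the signed area of the triangle `p q r`. -/
def cross (p q r : EuclideanSpace ℝ (Fin 2)) : ℝ :=
  (q 0 - p 0) * (r 1 - p 1) - (q 1 - p 1) * (r 0 - p 0)

/-- The coefficients of the affine dependency between four points of the plane. -/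
def bary (x : Fin 4 → EuclideanSpace ℝ (Fin 2)) : Fin 4 → ℝ :=
  ![cross (x 1) (x 2) (x 3), -cross (x 0) (x 2) (x 3), cross (x 0) (x 1) (x 3),
    -cross (x 0) (x 1) (x 2)]

section

variable {x : Fin 4 → EuclideanSpace ℝ (Fin 2)}

lemma sum_bary (x : Fin 4 → EuclideanSpace ℝ (Fin 2)) : ∑ i, bary x i = 0 := by
  simp [Fin.sum_univ_four, bary, cross]; ring

lemma sum_bary_mul (x : Fin 4 → EuclideanSpace ℝ (Fin 2)) (t : Fin 2) :
    ∑ i, bary x i * x i t = 0 := by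
  fin_cases t <;> simp [Fin.sum_univ_four, bary, cross] <;> ring

/-- Here ε is the sign of the permutation (i, j, k, l). Both areas share it, so it drops out of
homogeneous equations and of products. -/
lemma exists_sign_cross {i j k l : Fin 4} (hij : i ≠ j) (hik : i ≠ k) (hil : i ≠ l) (hjk : j ≠ k)
    (hjl : j ≠ l) (hkl : k ≠ l) : ∃ ε : ℝ, ε ^ 2 = 1 ∧
      cross (x i) (x j) (x l) = ε * bary x k ∧ cross (x i) (x k) (x l) = -ε * bary x j := by
  have h : (cross (x i) (x j) (x l) = 1 * bary x k ∧ cross (x i) (x k) (x l) = -1 * bary x j) ∨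
      (cross (x i) (x j) (x l) = (-1) * bary x k ∧ cross (x i) (x k) (x l) = -(-1) * bary x j) := by
    fin_cases i <;> fin_cases j <;> first | exact absurd rfl hij | skip
    all_goals fin_cases k <;> first | exact absurd rfl hik | exact absurd rfl hjk | skip
    all_goals fin_cases l <;>
      first | exact absurd rfl hil | exact absurd rfl hjl | exact absurd rfl hkl | skip
    all_goals
      simp only [bary, cross]
      first
        | (left; constructor <;> simp <;> ring1)
        | (right; constructor <;> simp <;> ring1)
  rcases h with h | h
  · exact ⟨1, by norm_num, h⟩
  · exact ⟨-1, by norm_num, h⟩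

/-- Dictionary between signs and geometry: i and j are on the same side of the line kl exactly when
their coefficients have opposite signs. -/
lemma cross_mul_cross {i j k l : Fin 4} (hij : i ≠ j) (hik : i ≠ k) (hil : i ≠ l) (hjk : j ≠ k)
    (hjl : j ≠ l) (hkl : k ≠ l) :
    cross (x k) (x l) (x i) * cross (x k) (x l) (x j) = -(bary x i * bary x j) := by
  obtain ⟨ε, hε, h1, h2⟩ := exists_sign_cross (x := x) hik.symm hjk.symm hkl hij hil hjl
  have e (p q r) : cross p q r = -cross p r q := by simp only [cross]; ring
  rw [e, e _ _ (x j), h1, h2]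
  linear_combination -(bary x i * bary x j) * hε

/-- Moments of squared distances do not depend on the vertex. -/
lemma sum_bary_mul_dist_sq (x : Fin 4 → EuclideanSpace ℝ (Fin 2)) (i : Fin 4) :
    ∑ j, bary x j * ‖x i - x j‖ ^ 2 = ∑ j, bary x j * ‖x j‖ ^ 2 := by
  have h0 := sum_bary_mul x 0
  have h1 := sum_bary_mul x 1
  have h := sum_bary x
  simp only [EuclideanSpace.norm_sq_eq, Fin.sum_univ_two, Real.norm_eq_abs, sq_abs,
    PiLp.sub_apply, Fin.sum_univ_four] at *
  linear_combination ((x i 0) ^ 2 + (x i 1) ^ 2) * h - 2 * x i 0 * h0 - 2 * x i 1 * h1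

lemma collinear_range_of_cross {ι : Type*} {y : ι → EuclideanSpace ℝ (Fin 2)}
    {p q : EuclideanSpace ℝ (Fin 2)} (hpq : p ≠ q) (h : ∀ i, cross p q (y i) = 0) :
    Collinear ℝ (Set.range y) := by
  rw [collinear_iff_exists_forall_eq_smul_vadd]
  have hn : ((q 0 - p 0) ^ 2 + (q 1 - p 1) ^ 2) ≠ 0 := by
    intro h0
    apply hpq
    have h1 : q 0 - p 0 = 0 := by nlinarith [sq_nonneg (q 0 - p 0), sq_nonneg (q 1 - p 1)]
    have h2 : q 1 - p 1 = 0 := by nlinarith [sq_nonneg (q 0 - p 0), sq_nonneg (q 1 - p 1)]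
    ext t; fin_cases t
    · simpa using (sub_eq_zero.1 h1).symm
    · simpa using (sub_eq_zero.1 h2).symm
  refine ⟨p, q - p, ?_⟩
  rintro _ ⟨i, rfl⟩
  refine ⟨((y i 0 - p 0) * (q 0 - p 0) + (y i 1 - p 1) * (q 1 - p 1)) /
    ((q 0 - p 0) ^ 2 + (q 1 - p 1) ^ 2), ?_⟩
  have hi := h i
  simp only [cross] at hi
  ext t
  fin_cases t
  · simp
    field_simp
    linear_combination -(q 1 - p 1) * hi
  · simp
    field_simp
    linear_combination (q 0 - p 0) * hi

/-- If both coefficients vanished, i and j would lie on the line through the other two points. -/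
lemma bary_ne_zero (hp : IsStrictlyPlanar x) (hx : Function.Injective x) {i j : Fin 4}
    (hij : i ≠ j) (hi : bary x i = 0) : bary x j ≠ 0 := by
  intro hj
  obtain ⟨k, l, hik, hil, hjk, hjl, hkl, hall⟩ : ∃ k l : Fin 4, i ≠ k ∧ i ≠ l ∧ j ≠ k ∧ j ≠ l ∧
      k ≠ l ∧ ∀ t, t = i ∨ t = j ∨ t = k ∨ t = l := by
    clear hi hj; decide +revert
  refine hp (collinear_range_of_cross (hx.ne hkl) fun t => ?_)
  obtain ⟨ε, hε, h1, h2⟩ := exists_sign_cross (x := x) hik.symm hjk.symm hkl hij hil hjl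
  have e (p q r) : cross p q r = -cross p r q := by simp only [cross]; ring
  rcases hall t with rfl | rfl | rfl | rfl
  · rw [e, h1, hj]; simp
  · rw [e, h2, hi]; simp
  · simp [cross]
  · simp [cross]; ring

/-- A matrix whose rows are off the diagonal proportional to one vector has rank one there. -/
lemma exists_eq_mul_mul {S : Fin 4 → Fin 4 → ℝ} {D : Fin 4 → ℝ} (hsymm : ∀ i j, S i j = S j i)
    (hS : ∀ i j k, i ≠ j → i ≠ k → j ≠ k → S i j * D k = S i k * D j)
    {a b : Fin 4} (hab : a ≠ b) (ha : D a ≠ 0) (hb : D b ≠ 0) :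
    ∃ μ, ∀ i j, i ≠ j → S i j = μ * (D i * D j) := by
  have key : ∀ j, a ≠ j → S a j = S a b / (D a * D b) * (D a * D j) := by
    intro j hj
    field_simp
    rcases eq_or_ne b j with rfl | hbj
    · ring
    · linear_combination hS a j b hj hab hbj.symm
  refine ⟨S a b / (D a * D b), fun i j hij => ?_⟩
  rcases eq_or_ne a i with rfl | hi
  · exact key j hij
  rcases eq_or_ne a j with rfl | hj
  · rw [hsymm, key i hi]; ring
  · apply mul_right_cancel₀ ha
    rw [hS i j a hij hi.symm hj.symm, hsymm i a, key i hi]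
    ring

/-! ### From the equations of motion to the Dziobek equations -/

/-- Coordinate form of the equations of a relative equilibrium. -/
lemma equilibrium_apply {n : ℕ} {Γ : Fin n → ℝ} {y : Fin n → EuclideanSpace ℝ (Fin 2)} {ω : ℝ}
    {c : EuclideanSpace ℝ (Fin 2)}
    (h : ∀ i, -ω • (y i - c) = ∑ j ∈ Finset.univ.erase i, (Γ j / ‖y i - y j‖ ^ 2) • (y j - y i))
    (i : Fin n) (t : Fin 2) :
    -ω * (y i t - c t) = ∑ j, Γ j * (‖y i - y j‖ ^ 2)⁻¹ * (y j t - y i t) := by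
  rw [← Finset.sum_erase (a := i) _ (by simp)]
  have := congrArg (fun v : EuclideanSpace ℝ (Fin 2) => v t) (h i)
  simpa [div_eq_mul_inv] using this

/-- The centre of rotation is the centre of vorticity. -/
lemma sum_strength_mul_center {n : ℕ} {Γ : Fin n → ℝ} {y : Fin n → EuclideanSpace ℝ (Fin 2)}
    {ω : ℝ} (hω : ω ≠ 0) {c : EuclideanSpace ℝ (Fin 2)}
    (h : ∀ i, -ω • (y i - c) = ∑ j ∈ Finset.univ.erase i, (Γ j / ‖y i - y j‖ ^ 2) • (y j - y i))
    (t : Fin 2) : (∑ i, Γ i) * c t = ∑ i, Γ i * y i t := by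
  have h1 : ∑ i, Γ i * (-ω * (y i t - c t)) =
      ∑ i, ∑ j, Γ i * (Γ j * (‖y i - y j‖ ^ 2)⁻¹ * (y j t - y i t)) := by
    simp_rw [equilibrium_apply h, Finset.mul_sum]
  -- The pair interactions are antisymmetric in i and j, so the double sum vanishes.
  have h2 : ∑ i, ∑ j, Γ i * (Γ j * (‖y i - y j‖ ^ 2)⁻¹ * (y j t - y i t)) =
      -∑ i, ∑ j, Γ i * (Γ j * (‖y i - y j‖ ^ 2)⁻¹ * (y j t - y i t)) := by
    conv_lhs => rw [Finset.sum_comm]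
    simp_rw [← Finset.sum_neg_distrib]
    refine Finset.sum_congr rfl fun i _ => Finset.sum_congr rfl fun j _ => ?_
    rw [norm_sub_rev (y j)]; ring
  have h3 : ∑ i, Γ i * (-ω * (y i t - c t)) = -ω * (∑ i, Γ i * y i t - (∑ i, Γ i) * c t) := by
    rw [Finset.sum_mul, ← Finset.sum_sub_distrib, Finset.mul_sum]
    exact Finset.sum_congr rfl fun i _ => by ring
  have h4 : -ω * (∑ i, Γ i * y i t - (∑ i, Γ i) * c t) = 0 := by linarith
  linarith [(mul_eq_zero.1 h4).resolve_left (neg_ne_zero.2 hω)]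

/-- Laura–Andoyer form of the equations for nonzero total strength. -/
lemma sum_strength_mul_sub {n : ℕ} {Γ : Fin n → ℝ} {y : Fin n → EuclideanSpace ℝ (Fin 2)}
    {ω : ℝ} (hω : ω ≠ 0) {c : EuclideanSpace ℝ (Fin 2)} (hΓ : ∑ i, Γ i ≠ 0)
    (h : ∀ i, -ω • (y i - c) = ∑ j ∈ Finset.univ.erase i, (Γ j / ‖y i - y j‖ ^ 2) • (y j - y i))
    (i : Fin n) (t : Fin 2) :
    ∑ j, Γ j * ((‖y i - y j‖ ^ 2)⁻¹ - ω / ∑ i, Γ i) * (y j t - y i t) = 0 := by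
  have h1 := sum_strength_mul_center hω h t
  have h2 := equilibrium_apply h i t
  have h3 : ∑ j, Γ j * ((‖y i - y j‖ ^ 2)⁻¹ - ω / ∑ i, Γ i) * (y j t - y i t) =
      ∑ j, Γ j * (‖y i - y j‖ ^ 2)⁻¹ * (y j t - y i t) -
        ω / (∑ i, Γ i) * (∑ j, Γ j * y j t - (∑ j, Γ j) * y i t) := by
    rw [Finset.sum_mul _ _ (y i t), ← Finset.sum_sub_distrib, Finset.mul_sum,
      ← Finset.sum_sub_distrib]
    exact Finset.sum_congr rfl fun j _ => by ring
  rw [h3, ← h1, ← h2]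
  field_simp
  ring

lemma sum_fin_four_eq {M : Type*} [AddCommMonoid M] (f : Fin 4 → M) {i j k l : Fin 4}
    (hij : i ≠ j) (hik : i ≠ k) (hil : i ≠ l) (hjk : j ≠ k) (hjl : j ≠ l) (hkl : k ≠ l) :
    ∑ t, f t = f i + (f j + (f k + f l)) := by
  have : (Finset.univ : Finset (Fin 4)) = {i, j, k, l} := by decide +revert
  rw [this, Finset.sum_insert (by simp [*]), Finset.sum_insert (by simp [*]),
    Finset.sum_insert (by simp [*]), Finset.sum_singleton]

/-- The Dziobek equations. -/
lemma exists_dziobek {Γ : Fin 4 → ℝ} (hΓ0 : ∀ i, Γ i ≠ 0) (hΓ : ∑ i, Γ i ≠ 0)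
    (hp : IsStrictlyPlanar x) (hx : IsRelativeEquilibrium Γ x) :
    ∃ (lam κ : ℝ) (D : Fin 4 → ℝ), (∀ i, bary x i = Γ i * D i) ∧
      ∀ i j, i ≠ j → ‖x i - x j‖ ^ 2 * (lam * (1 + κ * (D i * D j))) = 1 := by
  obtain ⟨hinj, ω, hω, c, h⟩ := hx
  obtain ⟨lam, hlam⟩ : ∃ lam, lam = ω / ∑ i, Γ i := ⟨_, rfl⟩
  have hlam0 : lam ≠ 0 := by rw [hlam]; exact div_ne_zero hω hΓ
  have hb : ∀ i, bary x i = Γ i * (bary x i / Γ i) := fun i => by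
    rw [mul_div_cancel₀ _ (hΓ0 i)]
  obtain ⟨D, hD⟩ : ∃ D : Fin 4 → ℝ, ∀ i, bary x i = Γ i * D i := ⟨_, hb⟩
  have hD0 : ∀ i j, i ≠ j → D i = 0 → D j ≠ 0 := fun i j hij hi hj =>
    bary_ne_zero hp hinj hij (by rw [hD, hi, mul_zero]) (by rw [hD, hj, mul_zero])
  obtain ⟨a, b, hab, ha, hb⟩ : ∃ a b, a ≠ b ∧ D a ≠ 0 ∧ D b ≠ 0 := by
    by_cases h0 : D 0 = 0
    · exact ⟨1, 2, by decide, hD0 0 1 (by decide) h0, hD0 0 2 (by decide) h0⟩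
    · by_cases h1 : D 1 = 0
      · exact ⟨0, 2, by decide, h0, hD0 1 2 (by decide) h1⟩
      · exact ⟨0, 1, by decide, h0, h1⟩
  obtain ⟨μ, hμ⟩ := exists_eq_mul_mul (S := fun i j => (‖x i - x j‖ ^ 2)⁻¹ - lam) (D := D)
    (fun i j => by simp only [norm_sub_rev]) (fun i j k hij hik hjk => by
      obtain ⟨l, hil, hjl, hkl⟩ : ∃ l : Fin 4, i ≠ l ∧ j ≠ l ∧ k ≠ l := by
        decide +revert
      have e0 := sum_strength_mul_sub hω hΓ h i 0
      have e1 := sum_strength_mul_sub hω hΓ h i 1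
      rw [sum_fin_four_eq _ hij hik hil hjk hjl hkl, ← hlam] at e0 e1
      obtain ⟨ε, hε, c1, c2⟩ := exists_sign_cross (x := x) hij hik hil hjk hjl hkl
      -- The cross product with x l - x i removes the term of l and leaves a relation between two
      -- distances only.
      have e : Γ j * ((‖x i - x j‖ ^ 2)⁻¹ - lam) * cross (x i) (x j) (x l) +
          Γ k * ((‖x i - x k‖ ^ 2)⁻¹ - lam) * cross (x i) (x k) (x l) = 0 := by
        simp only [cross]
        linear_combination e0 * (x l 1 - x i 1) - e1 * (x l 0 - x i 0)
      rw [c1, c2, hD, hD] at e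
      have hn : ε * (Γ j * Γ k) ≠ 0 := by
        refine mul_ne_zero ?_ (mul_ne_zero (hΓ0 j) (hΓ0 k))
        rintro rfl; norm_num at hε
      apply mul_left_cancel₀ hn
      linear_combination e) hab ha hb
  refine ⟨lam, μ / lam, D, hD, fun i j hij => ?_⟩
  have hn : ‖x i - x j‖ ^ 2 ≠ 0 := by
    have := norm_ne_zero_iff.2 (sub_ne_zero.2 (hinj.ne hij))
    positivity
  have hS := hμ i j hij
  have : lam * (1 + μ / lam * (D i * D j)) = lam + μ * (D i * D j) := by field_simp
  rw [this, ← hS, add_sub_cancel, mul_inv_cancel₀ hn]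

/-! ### Symmetric configurations -/

lemma norm_sub_sq_plane (p q : EuclideanSpace ℝ (Fin 2)) :
    ‖p - q‖ ^ 2 = (p 0 - q 0) ^ 2 + (p 1 - q 1) ^ 2 := by
  simp [EuclideanSpace.norm_sq_eq]

lemma reflection_line_eq {p q y z : EuclideanSpace ℝ (Fin 2)} (τ : ℝ)
    (hm : ∀ t, y t + z t = 2 * (p t + τ * (q t - p t)))
    (ho : (y 0 - z 0) * (q 0 - p 0) + (y 1 - z 1) * (q 1 - p 1) = 0) :
    EuclideanGeometry.reflection line[ℝ, p, q] y = z := by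
  have hy : y = (1 / 2 : ℝ) • (y - z) +ᵥ AffineMap.lineMap p q τ := by
    ext t
    simp [AffineMap.lineMap_apply]
    linear_combination hm t / 2
  have hz : z = -((1 / 2 : ℝ) • (y - z)) +ᵥ AffineMap.lineMap p q τ := by
    ext t
    simp [AffineMap.lineMap_apply]
    linear_combination hm t / 2
  have hv : (1 / 2 : ℝ) • (y - z) ∈ (line[ℝ, p, q]).directionᗮ := by
    refine Submodule.smul_mem _ _ ?_
    rw [direction_affineSpan, vectorSpan_pair_rev, Submodule.mem_orthogonal_singleton_iff_inner_right]
    simp [PiLp.inner_apply]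
    linear_combination ho
  conv_lhs => rw [hy]
  rw [EuclideanGeometry.reflection_orthogonal_vadd (AffineMap.lineMap_mem_affineSpan_pair _ _ _) hv]
  exact hz.symm

/-- A kite is symmetric. -/
lemma hasLineOfSymmetry_of_kite {Γ : Fin 4 → ℝ} (hp : IsStrictlyPlanar x)
    (hx : Function.Injective x) {i j k l : Fin 4}
    (hij : i ≠ j) (hik : i ≠ k) (hil : i ≠ l) (hjk : j ≠ k) (hjl : j ≠ l) (hkl : k ≠ l)
    (hΓ : Γ i = Γ j) (hb : bary x i = bary x j) (hk : ‖x i - x k‖ ^ 2 = ‖x j - x k‖ ^ 2)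
    (hl : ‖x i - x l‖ ^ 2 = ‖x j - x l‖ ^ 2) : HasLineOfSymmetry Γ x := by
  have hall : ∀ t, t = i ∨ t = j ∨ t = k ∨ t = l := by
    clear hΓ hb hk hl; decide +revert
  have hi : bary x i ≠ 0 := fun h => bary_ne_zero hp hx hij h (hb ▸ h)
  -- Equal coefficients at i and j put the midpoint of x i and x j on the line kl; the equal
  -- distances later give orthogonality.
  have hm : ∀ t, x i t + x j t = 2 * (x k t + -bary x l / (2 * bary x i) * (x l t - x k t)) := by
    intro t
    have h0 := sum_bary x
    have h1 := sum_bary_mul x t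
    rw [sum_fin_four_eq _ hij hik hil hjk hjl hkl, ← hb] at h0 h1
    field_simp
    linear_combination h1 - x k t * h0
  rw [norm_sub_sq_plane, norm_sub_sq_plane] at hk hl
  refine ⟨x k, x l, hx.ne hkl, Equiv.swap i j, fun t => ?_⟩
  rcases hall t with rfl | rfl | rfl | rfl
  · rw [Equiv.swap_apply_left]
    exact ⟨reflection_line_eq _ hm (by linear_combination (hk - hl) / 2), hΓ.symm⟩
  · rw [Equiv.swap_apply_right]
    exact ⟨reflection_line_eq _ (fun t => (add_comm _ _).trans (hm t))
      (by linear_combination -(hk - hl) / 2), hΓ⟩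
  · rw [Equiv.swap_apply_of_ne_of_ne hik.symm hjk.symm]
    exact ⟨reflection_line_eq 0 (fun t => by ring) (by ring), rfl⟩
  · rw [Equiv.swap_apply_of_ne_of_ne hil.symm hjl.symm]
    exact ⟨reflection_line_eq 1 (fun t => by ring) (by ring), rfl⟩

/-- An isosceles trapezoid is symmetric. -/
lemma hasLineOfSymmetry_of_trapezoid {Γ : Fin 4 → ℝ} (hp : IsStrictlyPlanar x)
    (hx : Function.Injective x) (h01 : Γ 0 = Γ 1) (h23 : Γ 2 = Γ 3)
    (hb : bary x 0 + bary x 1 = 0) (hb' : bary x 2 + bary x 3 = 0)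
    (h1 : ‖x 0 - x 2‖ ^ 2 = ‖x 1 - x 3‖ ^ 2) (h2 : ‖x 0 - x 3‖ ^ 2 = ‖x 1 - x 2‖ ^ 2) :
    HasLineOfSymmetry Γ x := by
  have hpar : ∀ t, bary x 0 * (x 0 t - x 1 t) + bary x 2 * (x 2 t - x 3 t) = 0 := by
    intro t
    have := sum_bary_mul x t
    rw [Fin.sum_univ_four] at this
    linear_combination this - x 1 t * hb - x 3 t * hb'
  have hb0 : bary x 0 ≠ 0 := fun h =>
    bary_ne_zero hp hx (i := 0) (j := 1) (by decide) h (by linarith)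
  have hb3 : bary x 3 ≠ 0 := fun h =>
    bary_ne_zero hp hx (i := 3) (j := 2) (by decide) h (by linarith)
  rw [norm_sub_sq_plane, norm_sub_sq_plane] at h1 h2
  have o1 : (x 0 0 - x 1 0) * (midpoint ℝ (x 2) (x 3) 0 - midpoint ℝ (x 0) (x 1) 0) +
      (x 0 1 - x 1 1) * (midpoint ℝ (x 2) (x 3) 1 - midpoint ℝ (x 0) (x 1) 1) = 0 := by
    simp [midpoint_eq_smul_add]
    linear_combination -(h1 + h2) / 4
  have o2 : (x 2 0 - x 3 0) * (midpoint ℝ (x 2) (x 3) 0 - midpoint ℝ (x 0) (x 1) 0) +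
      (x 2 1 - x 3 1) * (midpoint ℝ (x 2) (x 3) 1 - midpoint ℝ (x 0) (x 1) 1) = 0 := by
    simp [midpoint_eq_smul_add]
    linear_combination (h1 - h2) / 4
  refine ⟨midpoint ℝ (x 0) (x 1), midpoint ℝ (x 2) (x 3), fun h => ?_,
    Equiv.swap 0 1 * Equiv.swap 2 3, fun t => ?_⟩
  -- With a common midpoint, 01 and 23 would be diagonals of a parallelogram; being parallel by
  -- `hpar`, they would make it degenerate.
  · have e : ∀ t, x 0 t + x 1 t = x 2 t + x 3 t := fun t => by
      have := congrArg (fun v : EuclideanSpace ℝ (Fin 2) => v t) h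
      simp [midpoint_eq_smul_add] at this
      linarith
    have c3 : bary x 3 = -cross (x 0) (x 1) (x 2) := rfl
    refine hb3 ((mul_eq_zero.1 ?_).resolve_left hb0)
    rw [c3, cross]
    linear_combination hpar 0 * (x 2 1 - x 3 1) / 2 - hpar 1 * (x 2 0 - x 3 0) / 2 +
      bary x 0 / 2 * ((x 0 0 - x 1 0) * -e 1 - (x 0 1 - x 1 1) * -e 0)
  · have s0 : (Equiv.swap 0 1 * Equiv.swap 2 3 : Equiv.Perm (Fin 4)) 0 = 1 := by decide
    have s1 : (Equiv.swap 0 1 * Equiv.swap 2 3 : Equiv.Perm (Fin 4)) 1 = 0 := by decide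
    have s2 : (Equiv.swap 0 1 * Equiv.swap 2 3 : Equiv.Perm (Fin 4)) 2 = 3 := by decide
    have s3 : (Equiv.swap 0 1 * Equiv.swap 2 3 : Equiv.Perm (Fin 4)) 3 = 2 := by decide
    have hall : ∀ t : Fin 4, t = 0 ∨ t = 1 ∨ t = 2 ∨ t = 3 := by decide
    rcases hall t with rfl | rfl | rfl | rfl
    · rw [s0]
      refine ⟨reflection_line_eq 0 (fun t => ?_) o1, h01.symm⟩
      simp [midpoint_eq_smul_add]; ring
    · rw [s1]
      refine ⟨reflection_line_eq 0 (fun t => ?_) (by linear_combination -o1), h01⟩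
      simp [midpoint_eq_smul_add]; ring
    · rw [s2]
      refine ⟨reflection_line_eq 1 (fun t => ?_) o2, h23.symm⟩
      simp [midpoint_eq_smul_add]; ring
    · rw [s3]
      refine ⟨reflection_line_eq 1 (fun t => ?_) (by linear_combination -o2), h23⟩
      simp [midpoint_eq_smul_add]; ring

/-- For strengths `1, 1, -1, -1` a relative equilibrium is a rhombus. -/
lemma hasLineOfSymmetry_of_neg_one (hp : IsStrictlyPlanar x)
    (hx : IsRelativeEquilibrium (pairStrengths (-1)) x) :
    HasLineOfSymmetry (pairStrengths (-1)) x := by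
  obtain ⟨hinj, ω, hω, c, h⟩ := hx
  -- The total strength is zero, so the centre drops out and the vortices form a parallelogram with
  -- diagonals 01 and 23.
  have hpar : ∀ t, x 0 t + x 1 t = x 2 t + x 3 t := fun t => by
    have := sum_strength_mul_center hω h t
    simp [Fin.sum_univ_four, pairStrengths] at this
    linarith
  have d1 : ‖x 1 - x 3‖ ^ 2 = ‖x 0 - x 2‖ ^ 2 := by
    rw [norm_sub_sq_plane, norm_sub_sq_plane]
    linear_combination (x 1 0 - x 3 0 - x 0 0 + x 2 0) * hpar 0 +
      (x 1 1 - x 3 1 - x 0 1 + x 2 1) * hpar 1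
  have d2 : ‖x 1 - x 2‖ ^ 2 = ‖x 0 - x 3‖ ^ 2 := by
    rw [norm_sub_sq_plane, norm_sub_sq_plane]
    linear_combination (x 1 0 - x 2 0 - x 0 0 + x 3 0) * hpar 0 +
      (x 1 1 - x 2 1 - x 0 1 + x 3 1) * hpar 1
  have b2 : bary x 2 = cross (x 0) (x 1) (x 3) := rfl
  have b3 : bary x 3 = -cross (x 0) (x 1) (x 2) := rfl
  have hb : bary x 2 = bary x 3 := by
    rw [b2, b3, cross, cross]
    linear_combination -(x 1 0 - x 0 0) * hpar 1 + (x 1 1 - x 0 1) * hpar 0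
  have hb2 : bary x 2 ≠ 0 := fun h0 =>
    bary_ne_zero hp hinj (i := 2) (j := 3) (by decide) h0 (hb ▸ h0)
  have eq (t : Fin 2) : -ω * (x 0 t - x 1 t) =
      (2 * (‖x 0 - x 1‖ ^ 2)⁻¹ - (‖x 0 - x 2‖ ^ 2)⁻¹ - (‖x 0 - x 3‖ ^ 2)⁻¹) * (x 1 t - x 0 t) +
      ((‖x 0 - x 3‖ ^ 2)⁻¹ - (‖x 0 - x 2‖ ^ 2)⁻¹) * (x 2 t - x 3 t) := by
    have e0 := equilibrium_apply h 0 t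
    have e1 := equilibrium_apply h 1 t
    simp only [Fin.sum_univ_four, pairStrengths] at e0 e1
    rw [d1, d2, norm_sub_rev (x 1) (x 0)] at e1
    simp at e0 e1
    linear_combination e0 - e1
  have hd : ‖x 0 - x 3‖ ^ 2 = ‖x 0 - x 2‖ ^ 2 := by
    -- Only the last term of `eq` has a component normal to the diagonal 01, so its coefficient
    -- vanishes and adjacent sides are equal.
    have : ((‖x 0 - x 3‖ ^ 2)⁻¹ - (‖x 0 - x 2‖ ^ 2)⁻¹) * bary x 2 = 0 := by
      rw [b2, b3, cross, cross] at hb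
      rw [b2, cross]
      linear_combination (-(x 1 1 - x 0 1) * eq 0 + (x 1 0 - x 0 0) * eq 1) / 2 +
        ((‖x 0 - x 3‖ ^ 2)⁻¹ - (‖x 0 - x 2‖ ^ 2)⁻¹) / 2 * hb
    exact inv_injective (sub_eq_zero.1 ((mul_eq_zero.1 this).resolve_right hb2))
  refine hasLineOfSymmetry_of_kite hp hinj (i := 2) (j := 3) (k := 0) (l := 1) (by decide)
    (by decide) (by decide) (by decide) (by decide) (by decide) rfl hb ?_ ?_
  · rw [norm_sub_rev, ← hd, norm_sub_rev]
  · rw [norm_sub_rev, d2, hd, ← d1, norm_sub_rev]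

/-! ### Convexity and adjacency from signs -/

lemma mem_convexHull_triangle {p q r y : EuclideanSpace ℝ (Fin 2)}
    (hp : 0 < cross q r p * cross q r y) (hq : 0 < cross r p q * cross r p y)
    (hr : 0 < cross p q r * cross p q y) : y ∈ convexHull ℝ {p, q, r} := by
  have e1 : cross r p q = cross p q r := by simp only [cross]; ring
  have e2 : cross q r p = cross p q r := by simp only [cross]; ring
  rw [e1] at hq
  rw [e2] at hp
  have h0 : cross p q r ≠ 0 := by rintro h; simp [h] at hp
  have hsq : 0 < cross p q r ^ 2 := by positivity
  have hsum : cross q r y + cross r p y + cross p q y = cross p q r := by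
    simp only [cross]; ring
  have key := (convex_convexHull ℝ ({p, q, r} : Set (EuclideanSpace ℝ (Fin 2)))).sum_mem
    (t := Finset.univ) (w := ![cross q r y / cross p q r, cross r p y / cross p q r,
      cross p q y / cross p q r]) (z := ![p, q, r]) (by
        have aux : ∀ s, 0 < cross p q r * s → 0 ≤ s / cross p q r := fun s hs => by
          rw [show s / cross p q r = cross p q r * s / cross p q r ^ 2 by field_simp]
          positivity
        intro i _
        fin_cases i
        · exact aux _ hp
        · exact aux _ hq
        · exact aux _ hr)
      (by simp only [Fin.sum_univ_three]; simp; field_simp; exact hsum)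
      (fun i _ => subset_convexHull ℝ _ (by fin_cases i <;> simp))
  convert key using 1
  ext t
  simp only [Fin.sum_univ_three]
  simp
  field_simp
  fin_cases t
  · simp only [cross]; simp; ring
  · simp only [cross]; simp; ring

lemma continuous_cross (p q : EuclideanSpace ℝ (Fin 2)) : Continuous (cross p q) := by
  unfold cross; fun_prop

/-- The strict sign conditions cut out an open set contained in the triangle. -/
lemma mem_interior_convexHull_triangle {p q r y : EuclideanSpace ℝ (Fin 2)}
    (hp : 0 < cross q r p * cross q r y) (hq : 0 < cross r p q * cross r p y)
    (hr : 0 < cross p q r * cross p q y) : y ∈ interior (convexHull ℝ {p, q, r}) := by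
  rw [mem_interior]
  refine ⟨{z | 0 < cross q r p * cross q r z} ∩
    ({z | 0 < cross r p q * cross r p z} ∩ {z | 0 < cross p q r * cross p q z}),
    fun z hz => mem_convexHull_triangle hz.1 hz.2.1 hz.2.2, ?_, hp, hq, hr⟩
  have h (p q r : EuclideanSpace ℝ (Fin 2)) : IsOpen {z | 0 < cross p q r * cross p q z} :=
    isOpen_lt continuous_const (continuous_const.mul (continuous_cross p q))
  exact (h _ _ _).inter ((h _ _ _).inter (h _ _ _))

/-- A vortex whose barycentric coefficient has the sign opposite to all others is interior. -/
lemma isInteriorVortex_of_bary {k : Fin 4} (h : ∀ j, j ≠ k → bary x j * bary x k < 0) :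
    IsInteriorVortex x k := by
  obtain ⟨i, j, l, hki, hkj, hkl, hij, hil, hjl⟩ : ∃ i j l : Fin 4, k ≠ i ∧ k ≠ j ∧ k ≠ l ∧
      i ≠ j ∧ i ≠ l ∧ j ≠ l := by clear h; decide +revert
  have hmem : x k ∈ interior (convexHull ℝ {x i, x j, x l}) := by
    refine mem_interior_convexHull_triangle ?_ ?_ ?_
    · rw [cross_mul_cross hki.symm hij hil hkj hkl hjl]; linarith [h i hki.symm]
    · rw [cross_mul_cross hkj.symm hjl hij.symm hkl hki hil.symm]; linarith [h j hkj.symm]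
    · rw [cross_mul_cross hkl.symm hil.symm hjl.symm hki hkj hij]; linarith [h l hkl.symm]
  refine interior_mono (convexHull_mono ?_) hmem
  rintro _ (rfl | rfl | rfl)
  · exact ⟨i, hki.symm, rfl⟩
  · exact ⟨j, hkj.symm, rfl⟩
  · exact ⟨l, hkl.symm, rfl⟩

/-- A vortex whose barycentric coefficient has the sign of another one is not in the convex hull
of the others. -/
lemma notMem_convexHull_of_bary {k j : Fin 4} (hkj : k ≠ j) (h : 0 < bary x k * bary x j) :
    x k ∉ convexHull ℝ (x '' {k}ᶜ) := by
  obtain ⟨i, l, hki, hkl, hji, hjl, hil, hall⟩ : ∃ i l : Fin 4, k ≠ i ∧ k ≠ l ∧ j ≠ i ∧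
      j ≠ l ∧ i ≠ l ∧ ∀ t, t = k ∨ t = j ∨ t = i ∨ t = l := by clear h; decide +revert
  have hk := cross_mul_cross (x := x) hkj hki hkl hji hjl hil
  -- This half-plane bounded by the line il contains j, i and l, while k is strictly on the other
  -- side.
  have hconv : Convex ℝ {y | 0 ≤ cross (x i) (x l) (x j) * cross (x i) (x l) y} := by
    intro y hy z hz a b ha hb hab
    simp only [Set.mem_ofPred_eq] at *
    have : cross (x i) (x l) (a • y + b • z) =
        a * cross (x i) (x l) y + b * cross (x i) (x l) z := by
      obtain rfl : a = 1 - b := by linarith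
      simp [cross]; ring
    rw [this]
    nlinarith [mul_nonneg ha hy, mul_nonneg hb hz]
  intro hmem
  have hsub : x '' {k}ᶜ ⊆ {y | 0 ≤ cross (x i) (x l) (x j) * cross (x i) (x l) y} := by
    rintro _ ⟨t, ht, rfl⟩
    rcases hall t with rfl | rfl | rfl | rfl
    · exact absurd rfl ht
    · exact mul_self_nonneg (cross (x i) (x l) _)
    · simp [cross]
    · simp [cross, mul_comm]
  have := convexHull_min hsub hconv hmem
  simp only [Set.mem_ofPred_eq] at this
  linarith

lemma cross_eq_zero_of_mem {p q y : EuclideanSpace ℝ (Fin 2)} (h : y ∈ line[ℝ, p, q]) :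
    cross p q y = 0 := by
  obtain ⟨r, rfl⟩ := mem_affineSpan_pair_iff_exists_lineMap_eq.1 h
  simp [cross, AffineMap.lineMap_apply]; ring

lemma sSameSide_of_cross {p q y z : EuclideanSpace ℝ (Fin 2)}
    (h : 0 < cross p q y * cross p q z) : line[ℝ, p, q].SSameSide y z := by
  have hz : cross p q z ≠ 0 := by rintro h0; simp [h0] at h
  rw [AffineSubspace.sSameSide_iff_exists_left (left_mem_affineSpan_pair ℝ p q)]
  refine ⟨fun hm => ?_, fun hm => hz (cross_eq_zero_of_mem hm), ?_⟩
  · simp [cross_eq_zero_of_mem hm] at h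
  · have hr : 0 < cross p q y / cross p q z := by
      rw [show cross p q y / cross p q z = cross p q y * cross p q z / cross p q z ^ 2 by
        field_simp]
      positivity
    by_cases hy : cross p q y = 0
    · simp [hy] at h
    -- The witness is where the parallel to y - p through z meets the line pq.
    refine ⟨AffineMap.lineMap p q (cross p z y / cross p q y),
      AffineMap.lineMap_mem_affineSpan_pair _ _ _, ?_⟩
    have : y -ᵥ p = (cross p q y / cross p q z) •
        (z -ᵥ AffineMap.lineMap p q (cross p z y / cross p q y)) := by
      ext t
      simp [AffineMap.lineMap_apply]
      field_simp
      fin_cases t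
      · simp only [cross]; simp; ring
      · simp only [cross]; simp; ring
    rw [this]
    exact SameRay.sameRay_pos_smul_left _ hr

lemma areAdjacent_of_bary {i j k l : Fin 4} (hij : i ≠ j) (hik : i ≠ k) (hil : i ≠ l)
    (hjk : j ≠ k) (hjl : j ≠ l) (hkl : k ≠ l) (h : bary x k * bary x l < 0) :
    AreAdjacent x i j := by
  have hall : ∀ t, t = i ∨ t = j ∨ t = k ∨ t = l := by clear h; decide +revert
  have hc := cross_mul_cross (x := x) hkl hik.symm hjk.symm hil.symm hjl.symm hij
  have h1 : 0 < cross (x i) (x j) (x k) * cross (x i) (x j) (x l) := by linarith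
  have hk : cross (x i) (x j) (x k) ≠ 0 := by intro h0; simp [h0] at h1
  have hl : cross (x i) (x j) (x l) ≠ 0 := by intro h0; simp [h0] at h1
  intro s t hsi hsj hti htj
  apply sSameSide_of_cross
  rcases hall s with rfl | rfl | rfl | rfl
  · exact absurd rfl hsi
  · exact absurd rfl hsj
  all_goals rcases hall t with rfl | rfl | rfl | rfl
  any_goals exact absurd rfl hti
  any_goals exact absurd rfl htj
  · exact mul_self_pos.2 hk
  · exact h1
  · rwa [mul_comm]
  · exact mul_self_pos.2 hl

/-! ### Asymmetric relative equilibria -/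

/-- Signs of the barycentric coefficients of an asymmetric relative equilibrium. -/
lemma bary_signs_of_asymmetric {m : ℝ} (hm : m ≠ 0) (hp : IsStrictlyPlanar x)
    (hx : IsRelativeEquilibrium (pairStrengths m) x)
    (hs : ¬ HasLineOfSymmetry (pairStrengths m) x) :
    (0 < m → m < 1 ∧ bary x 0 * bary x 1 < 0 ∧ 0 < bary x 2 * bary x 3 ∨
      1 < m ∧ 0 < bary x 0 * bary x 1 ∧ bary x 2 * bary x 3 < 0) ∧
      (m < 0 → bary x 0 * bary x 1 < 0 ∧ bary x 2 * bary x 3 < 0) := by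
  have hm1 : m ≠ -1 := by
    rintro rfl; exact hs (hasLineOfSymmetry_of_neg_one hp hx)
  have hinj := hx.1
  obtain ⟨lam, κ, D, hD, hd⟩ := exists_dziobek (Γ := pairStrengths m)
    (by intro i; fin_cases i <;> simp [pairStrengths, hm])
    (by
      simp [Fin.sum_univ_four, pairStrengths]
      intro h; exact hm1 (by linarith)) hp hx
  have hlam : lam ≠ 0 := by
    rintro rfl; simpa using hd 0 1 (by decide)
  have b0 : bary x 0 = D 0 := by simpa [pairStrengths] using hD 0
  have b1 : bary x 1 = D 1 := by simpa [pairStrengths] using hD 1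
  have b2 : bary x 2 = m * D 2 := by simpa [pairStrengths] using hD 2
  have b3 : bary x 3 = m * D 3 := by simpa [pairStrengths] using hD 3
  have hsum : D 0 + D 1 + m * (D 2 + D 3) = 0 := by
    have := sum_bary x
    rw [Fin.sum_univ_four, b0, b1, b2, b3] at this
    linear_combination this
  have he : ∀ i j, i ≠ j → 1 + κ * (D i * D j) ≠ 0 := fun i j hij h => by
    have := hd i j hij
    rw [h] at this
    simp at this
  have hr : ∀ i j, i ≠ j → lam * ‖x i - x j‖ ^ 2 = 1 / (1 + κ * (D i * D j)) := fun i j hij => by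
    rw [eq_div_iff (he i j hij)]
    linear_combination hd i j hij
  have hdist : ∀ i j k l, i ≠ j → k ≠ l → D i * D j = D k * D l →
      ‖x i - x j‖ ^ 2 = ‖x k - x l‖ ^ 2 := fun i j k l hij hkl h => by
    apply mul_left_cancel₀ hlam
    rw [hr i j hij, hr k l hkl, h]
  have h01 : D 0 ≠ D 1 := fun h => hs <|
    hasLineOfSymmetry_of_kite hp hinj (i := 0) (j := 1) (k := 2) (l := 3) (by decide)
      (by decide) (by decide) (by decide) (by decide) (by decide) rfl (by rw [b0, b1, h])
      (hdist _ _ _ _ (by decide) (by decide) (by rw [h]))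
      (hdist _ _ _ _ (by decide) (by decide) (by rw [h]))
  have h23 : D 2 ≠ D 3 := fun h => hs <|
    hasLineOfSymmetry_of_kite hp hinj (i := 2) (j := 3) (k := 0) (l := 1) (by decide)
      (by decide) (by decide) (by decide) (by decide) (by decide) rfl (by rw [b2, b3, h])
      (hdist _ _ _ _ (by decide) (by decide) (by rw [h]))
      (hdist _ _ _ _ (by decide) (by decide) (by rw [h]))
  have hu : D 2 + D 3 ≠ 0 := fun h => by
    rw [h, mul_zero, add_zero] at hsum
    have e0 : D 0 = -D 1 := by linarith
    have e2 : D 2 = -D 3 := by linarith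
    exact hs (hasLineOfSymmetry_of_trapezoid hp hinj rfl rfl (by rw [b0, b1, hsum])
      (by rw [b2, b3, ← mul_add, h, mul_zero])
      (hdist _ _ _ _ (by decide) (by decide) (by rw [e0, e2]; ring))
      (hdist _ _ _ _ (by decide) (by decide) (by rw [e0, e2]; ring)))
  obtain ⟨T, ht⟩ : ∃ T, ∀ i, ∑ j, bary x j * (lam * ‖x i - x j‖ ^ 2) = T := by
    refine ⟨lam * ∑ j, bary x j * ‖x j‖ ^ 2, fun i => ?_⟩
    rw [← sum_bary_mul_dist_sq x i, Finset.mul_sum]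
    exact Finset.sum_congr rfl fun j _ => by ring
  have t0 := ht 0
  have t1 := ht 1
  have t2 := ht 2
  have t3 := ht 3
  simp only [Fin.sum_univ_four, b0, b1, b2, b3, sub_self, norm_zero] at t0 t1 t2 t3
  have key := asymmetric_signs hm hm1 h01 h23 hu hsum (he 0 1 (by decide)) (he 0 2 (by decide))
    (he 0 3 (by decide)) (he 1 2 (by decide)) (he 1 3 (by decide)) (he 2 3 (by decide))
    rfl rfl rfl rfl rfl rfl (t := T)
    (by linear_combination t0 - D 1 * hr 0 1 (by decide) - m * D 2 * hr 0 2 (by decide) -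
      m * D 3 * hr 0 3 (by decide))
    (by linear_combination t1 - D 0 * hr 1 0 (by decide) - m * D 2 * hr 1 2 (by decide) -
      m * D 3 * hr 1 3 (by decide))
    (by linear_combination t2 - D 0 * hr 2 0 (by decide) - D 1 * hr 2 1 (by decide) -
      m * D 3 * hr 2 3 (by decide))
    (by linear_combination t3 - D 0 * hr 3 0 (by decide) - D 1 * hr 3 1 (by decide) -
      m * D 2 * hr 3 2 (by decide))
  have hmm : 0 < m ^ 2 := by positivity
  have e23 : m * D 2 * (m * D 3) = m ^ 2 * (D 2 * D 3) := by ring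
  rw [b0, b1, b2, b3, e23]
  refine ⟨fun h => ?_, fun h => ?_⟩
  · rcases key.1 h with ⟨h1, h2, h3⟩ | ⟨h1, h2, h3⟩
    · exact .inl ⟨h1, h2, mul_pos hmm h3⟩
    · exact .inr ⟨h1, h2, mul_neg_of_pos_of_neg hmm h3⟩
  · exact ⟨(key.2 h).1, mul_neg_of_pos_of_neg hmm (key.2 h).2⟩

/-- One of two vortices with coefficients of opposite signs is interior, if the other two
coefficients have the same sign. -/
lemma exists_isInteriorVortex {i j k l : Fin 4} (hall : ∀ t, t = i ∨ t = j ∨ t = k ∨ t = l)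
    (hij : bary x i * bary x j < 0) (hkl : 0 < bary x k * bary x l) :
    IsInteriorVortex x i ∨ IsInteriorVortex x j := by
  have hk : bary x k ≠ 0 := by intro h; simp [h] at hkl
  have step (i j : Fin 4) (hall : ∀ t, t = i ∨ t = j ∨ t = k ∨ t = l)
      (hij : bary x i * bary x j < 0) (hik : bary x k * bary x i < 0) :
      IsInteriorVortex x i := by
    refine isInteriorVortex_of_bary fun t ht => ?_
    rcases hall t with rfl | rfl | rfl | rfl
    · exact absurd rfl ht
    · linarith
    · exact hik
    · have : 0 < (bary x k) ^ 2 := by positivity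
      by_contra! h
      nlinarith [mul_neg_of_pos_of_neg hkl hik]
  -- Of i and j, the interior vortex is the one whose sign differs from the common sign of k and l.
  rcases lt_trichotomy (bary x k * bary x i) 0 with h | h | h
  · exact .inl (step i j hall hij h)
  · rcases mul_eq_zero.1 h with h | h
    · exact absurd h hk
    · simp [h] at hij
  · refine .inr (step j i (fun t => ?_) (by linarith) ?_)
    · rcases hall t with h | h | h | h <;> simp [h]
    · by_contra! h'
      have : 0 < (bary x k) ^ 2 := by positivity
      nlinarith [mul_nonneg h.le h']

end

theorem mainTheorem1 (m : ℝ) (x : Fin 4 → EuclideanSpace ℝ (Fin 2))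
    (hplanar : IsStrictlyPlanar x) (hx : IsRelativeEquilibrium (pairStrengths m) x) :
    (0 < m →
      (IsConvexConfiguration x → HasLineOfSymmetry (pairStrengths m) x) ∧
      (¬ HasLineOfSymmetry (pairStrengths m) x →
        IsConcaveConfiguration x ∧
        (m < 1 → IsOnExteriorTriangle x 2 ∧ IsOnExteriorTriangle x 3) ∧
        (1 < m → IsOnExteriorTriangle x 0 ∧ IsOnExteriorTriangle x 1)) ∧
      (m = 1 → HasLineOfSymmetry (pairStrengths m) x)) ∧
    (m < 0 →
      (IsConcaveConfiguration x → HasLineOfSymmetry (pairStrengths m) x) ∧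
      (¬ HasLineOfSymmetry (pairStrengths m) x →
        IsConvexConfiguration x ∧ AreAdjacent x 0 1 ∧ AreAdjacent x 2 3)) := by
  refine ⟨fun hm => ?_, fun hm => ?_⟩
  · have concave (hs : ¬ HasLineOfSymmetry (pairStrengths m) x) :
        ∃ k, IsInteriorVortex x k ∧ m ≠ 1 ∧ (m < 1 → (2 : Fin 4) ≠ k ∧ (3 : Fin 4) ≠ k) ∧
          (1 < m → (0 : Fin 4) ≠ k ∧ (1 : Fin 4) ≠ k) := by
      rcases (bary_signs_of_asymmetric hm.ne' hplanar hx hs).1 hm with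
        ⟨h1, h2, h3⟩ | ⟨h1, h2, h3⟩
      · rcases exists_isInteriorVortex (by decide) h2 h3 with h | h
        · exact ⟨_, h, h1.ne, fun _ => by decide, fun h' => absurd h' h1.not_gt⟩
        · exact ⟨_, h, h1.ne, fun _ => by decide, fun h' => absurd h' h1.not_gt⟩
      · rcases exists_isInteriorVortex (by decide) h3 h2 with h | h
        · exact ⟨_, h, h1.ne', fun h' => absurd h' h1.not_gt, fun _ => by decide⟩
        · exact ⟨_, h, h1.ne', fun h' => absurd h' h1.not_gt, fun _ => by decide⟩
    refine ⟨fun hc => ?_, fun hs => ?_, fun h1 => ?_⟩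
    · by_contra hs
      obtain ⟨k, hk, -⟩ := concave hs
      exact hc k (interior_subset hk)
    · obtain ⟨k, hk, -, h1, h2⟩ := concave hs
      exact ⟨⟨k, hk⟩, fun h => ⟨⟨k, hk, (h1 h).1⟩, ⟨k, hk, (h1 h).2⟩⟩,
        fun h => ⟨⟨k, hk, (h2 h).1⟩, ⟨k, hk, (h2 h).2⟩⟩⟩
    · by_contra hs
      obtain ⟨k, -, h, -⟩ := concave hs
      exact h h1
  · have convex (hs : ¬ HasLineOfSymmetry (pairStrengths m) x) :
        IsConvexConfiguration x ∧ AreAdjacent x 0 1 ∧ AreAdjacent x 2 3 := by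
      obtain ⟨h1, h2⟩ := (bary_signs_of_asymmetric hm.ne hplanar hx hs).2 hm
      refine ⟨fun k hk => ?_, areAdjacent_of_bary (by decide) (by decide) (by decide) (by decide)
        (by decide) (by decide) h2, areAdjacent_of_bary (by decide) (by decide) (by decide)
        (by decide) (by decide) (by decide) h1⟩
      -- Membership in the hull forces every other coefficient to be zero or opposite in sign to
      -- that of k, but the pair not containing k has strictly opposite signs.
      have hle : ∀ j, k ≠ j → bary x k * bary x j ≤ 0 := fun j hj =>
        not_lt.1 fun h => notMem_convexHull_of_bary hj h hk
      have absurd_of (a b : Fin 4) (ha : k ≠ a) (hb : k ≠ b) (hk0 : bary x k ≠ 0)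
          (hab : bary x a * bary x b < 0) : False := by
        have h3 : 0 < bary x k ^ 2 := by positivity
        nlinarith [mul_nonneg_of_nonpos_of_nonpos (hle a ha) (hle b hb),
          mul_neg_of_pos_of_neg h3 hab]
      have hne : bary x 0 ≠ 0 ∧ bary x 1 ≠ 0 := mul_ne_zero_iff.1 h1.ne
      have hne' : bary x 2 ≠ 0 ∧ bary x 3 ≠ 0 := mul_ne_zero_iff.1 h2.ne
      fin_cases k
      · exact absurd_of 2 3 (by decide) (by decide) hne.1 h2
      · exact absurd_of 2 3 (by decide) (by decide) hne.2 h2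
      · exact absurd_of 0 1 (by decide) (by decide) hne'.1 h1
      · exact absurd_of 0 1 (by decide) (by decide) hne'.2 h1
    refine ⟨fun ⟨k, hk⟩ => ?_, convex⟩
    by_contra hs
    exact (convex hs).1 k (interior_subset hk)
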